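/- Let $\Omega\subset\mathbb R^n$ be open (for instance a bounded Lipschitz domain). Let $\mathcal M(\Omega)^n$ be the space of finite $\mathbb R^n$-valued Borel measures on $\Omega$, normed by the total variation $\|\mu\|_{\mathcal M(\Omega)}=|\mu|(\Omega)$ (with respect to the Euclidean norm on $\mathbb R^n$). Let $BV(\Omega)$ be the space of all $u\in L^1(\Omega)$ whose distributional gradient $\nabla u$ belongs to $\mathcal M(\Omega)^n$, with $\|u\|_{BV(\Omega)}=\|u\|_{L^1(\Omega)}+|\nabla u|(\Omega)$, and let $X=BV(\Omega)\cap L^2(\Omega)$ with norm $\|u\|_{BV(\Omega)}+\|u\|_{L^2(\Omega)}$. Let $U_{ad}\subset L^2(\Omega)$ be convex and closed with $U_{ad}\cap BV(\Omega)\neq\emptyset$, let $f:L^2(\Omega)\to\mathbb R$ be continuously Fréchet differentiable, with gradient $\nabla f(u)\in L^2(\Omega)$, and put $J(u)=f(u)+|\nabla u|(\Omega)$ for $u\in X$. **Theorem 2.5.** Let $\bar u\in BV(\Omega)\cap U_{ad}$ be locally optimal, i.e. there is $r>0$ such that $J(\bar u)\le J(u)$ for all $u\in U_{ad}\cap BV(\Omega)$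 with $\|u-\bar u\|_{BV(\Omega)}+\|u-\bar u\|_{L^2(\Omega)}<r$. Then there is $\lambda\in\partial\|\cdot\|_{\mathcal M(\Omega)}(\nabla\bar u)\subset(\mathcal M(\Omega)^n)^*$ such that $$-\nabla f(\bar u)\in-\operatorname{div}\lambda+N_{U_{ad}}(\bar u)\quad\text{in }X^*.$$ Here $\partial$ is the convex subdifferential, $-\operatorname{div}:(\mathcal M(\Omega)^n)^*\to X^*$ is the adjoint of $\nabla:X\to\mathcal M(\Omega)^n$, $\nabla f(\bar u)$ is regarded as the functional $v\mapsto\int_\Omega\nabla f(\bar u)\,v\,dx$ on $X$, and $$N_{U_{ad}}(\bar u)=\{\mu\in X^*:\ \langle\mu,u-\bar u\rangle\le0\ \ \forall u\in U_{ad}\cap BV(\Omega)\}.$$ -/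

import Mathlib

open MeasureTheory Set TopologicalSpace
open scoped ENNReal Topology Distributions Pointwise RealInnerProductSpace

noncomputable section

/-! ### Vector-valued Borel measures and the total variation norm -/

/-- The space `𝓜(Ω)ⁿ` of (finite) `ℝⁿ`-valued Borel measures on the open set `Ω ⊆ ℝⁿ`. -/
def VMeasure {n : ℕ} (Ω : Opens (EuclideanSpace ℝ (Fin n))) : Type :=
  VectorMeasure Ω (EuclideanSpace ℝ (Fin n))

namespace VMeasure

variable {n : ℕ} {Ω : Opens (EuclideanSpace ℝ (Fin n))}

instance : AddCommGroup (VMeasure Ω) :=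
  inferInstanceAs (AddCommGroup (VectorMeasure Ω (EuclideanSpace ℝ (Fin n))))

instance : Module ℝ (VMeasure Ω) :=
  inferInstanceAs (Module ℝ (VectorMeasure Ω (EuclideanSpace ℝ (Fin n))))

/-- The underlying vector measure. -/
def toVectorMeasure (μ : VMeasure Ω) : VectorMeasure Ω (EuclideanSpace ℝ (Fin n)) := μ

/-- A vector measure with values in `ℝⁿ` has finite total variation. -/
instance isFiniteMeasure_variation (μ : VectorMeasure Ω (EuclideanSpace ℝ (Fin n))) :
    IsFiniteMeasure μ.variation := by
  let p : Fin n → EuclideanSpace ℝ (Fin n) →L[ℝ] ℝ := fun i => EuclideanSpace.proj i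
  let c : Fin n → SignedMeasure Ω := fun i =>
    μ.mapRange (p i).toLinearMap.toAddMonoidHom (p i).continuous
  have h : μ.variation ≤ ∑ i, (c i).totalVariation := by
    apply VectorMeasure.variation_le_of_forall_enorm_le
    intro E hE
    have h1 : ‖μ E‖ₑ ≤ ∑ i, ‖(μ E) i‖ₑ := by
      have h2 : μ E = ∑ i, (μ E) i • EuclideanSpace.single i (1 : ℝ) := by
        ext j
        simp [Pi.single_apply]
      have h3 : ‖∑ i, (μ E) i • EuclideanSpace.single i (1 : ℝ)‖ ≤ ∑ i, ‖(μ E) i‖ := by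
        refine (norm_sum_le _ _).trans (Finset.sum_le_sum fun i _ => ?_)
        rw [norm_smul]
        simp
      rw [← h2] at h3
      simp only [enorm_eq_nnnorm]
      have h4 : ‖μ E‖₊ ≤ ∑ i, ‖(μ E) i‖₊ := by
        rw [← NNReal.coe_le_coe]
        push_cast
        exact h3
      exact_mod_cast h4
    refine h1.trans ?_
    rw [Measure.finsetSum_apply]
    exact Finset.sum_le_sum fun i _ => SignedMeasure.enorm_le_totalVariation (c i) E
  exact isFiniteMeasure_of_le _ h

/-- `‖μ‖ = |μ|(Ω)`: the total variation of `μ`, taken with respect to the Euclidean norm. -/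
instance : Norm (VMeasure Ω) := ⟨fun μ => (μ.toVectorMeasure.variation univ).toReal⟩

lemma norm_def (μ : VMeasure Ω) : ‖μ‖ = (μ.toVectorMeasure.variation univ).toReal := rfl

instance : NormedAddCommGroup (VMeasure Ω) :=
  AddGroupNorm.toNormedAddCommGroup
    { toFun := fun μ => ‖μ‖
      map_zero' := by
        have : (VectorMeasure.variation (0 : VectorMeasure Ω (EuclideanSpace ℝ (Fin n)))) = 0 :=
          VectorMeasure.variation_zero
        change (VectorMeasure.variation
          (0 : VectorMeasure Ω (EuclideanSpace ℝ (Fin n))) univ).toReal = 0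
        simp
      add_le' := fun μ ν => by
        change (VectorMeasure.variation (μ.toVectorMeasure + ν.toVectorMeasure) univ).toReal ≤
          (VectorMeasure.variation μ.toVectorMeasure univ).toReal +
          (VectorMeasure.variation ν.toVectorMeasure univ).toReal
        rw [← ENNReal.toReal_add (measure_ne_top _ _) (measure_ne_top _ _)]
        refine ENNReal.toReal_mono (by finiteness) ?_
        exact VectorMeasure.variation_add_le (μ := μ.toVectorMeasure) (ν := ν.toVectorMeasure) univ
      neg' := fun μ => by
        change (VectorMeasure.variation (-μ.toVectorMeasure) univ).toReal = _
        rw [VectorMeasure.variation_neg]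
        rfl
      eq_zero_of_map_eq_zero' := fun μ h => by
        have h0 : VectorMeasure.variation μ.toVectorMeasure univ = 0 :=
          ((ENNReal.toReal_eq_zero_iff _).1 h).resolve_right (measure_ne_top _ _)
        refine VectorMeasure.ext (s := μ.toVectorMeasure)
          (t := (0 : VectorMeasure Ω (EuclideanSpace ℝ (Fin n)))) fun E _ => ?_
        have h1 := VectorMeasure.enorm_measure_le_variation μ.toVectorMeasure E
        have h2 : VectorMeasure.variation μ.toVectorMeasure E = 0 :=
          measure_mono_null (subset_univ _) h0
        rw [h2] at h1
        simpa using h1 }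

instance : NormedSpace ℝ (VMeasure Ω) where
  norm_smul_le c μ := by
    change (VectorMeasure.variation (c • μ.toVectorMeasure) univ).toReal ≤
      ‖c‖ * (VectorMeasure.variation μ.toVectorMeasure univ).toReal
    rw [VectorMeasure.variation_smul]
    simp

end VMeasure

/-! ### Functions of bounded variation -/

section BV

variable {n : ℕ} (Ω : Opens (EuclideanSpace ℝ (Fin n)))

/-- Lebesgue measure on the open set `Ω`. -/
abbrev lebesgue : Measure Ω :=
  Measure.comap (Subtype.val : Ω → EuclideanSpace ℝ (Fin n)) volume

/-- `μ` is the distributional gradient of `u` on `Ω`: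
`∫_Ω u ∇φ dx = - ∫_Ω φ dμ` (an identity in `ℝⁿ`) for all `φ ∈ C_c^∞(Ω)`. -/
def IsDistribGradient {Ω : Opens (EuclideanSpace ℝ (Fin n))}
    (u : Ω →ₘ[(lebesgue Ω)] ℝ) (μ : VMeasure Ω) : Prop :=
  ∀ φ : 𝓓(Ω, ℝ),
    ∫ x : Ω, u x • gradient (φ : EuclideanSpace ℝ (Fin n) → ℝ) (x : EuclideanSpace ℝ (Fin n))
        ∂(lebesgue Ω) =
      - ∫ᵛ x : Ω, φ (x : EuclideanSpace ℝ (Fin n)) ∂•μ.toVectorMeasure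

variable {Ω}

lemma integrable_test (μ : VMeasure Ω) (φ : 𝓓(Ω, ℝ)) :
    μ.toVectorMeasure.Integrable
      (fun x : Ω => φ (x : EuclideanSpace ℝ (Fin n))) := by
  obtain ⟨C, hC⟩ := (map_continuous φ).bounded_above_of_compact_support
    (TestFunctionClass.map_hasCompactSupport φ)
  refine Integrable.of_bound (C := C) ?_ (Filter.Eventually.of_forall fun x => hC x)
  exact ((map_continuous φ).comp continuous_subtype_val).aestronglyMeasurable

lemma integrable_smul_gradient {u : Ω →ₘ[(lebesgue Ω)] ℝ}
    (hu : u ∈ Lp ℝ 1 (lebesgue Ω)) (φ : 𝓓(Ω, ℝ)) :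
    Integrable (fun x : Ω => u x • gradient (φ : EuclideanSpace ℝ (Fin n) → ℝ)
      (x : EuclideanSpace ℝ (Fin n))) (lebesgue Ω) := by
  have hd : ContDiff ℝ ((⊤ : ℕ∞) : WithTop ℕ∞) (φ : EuclideanSpace ℝ (Fin n) → ℝ) :=
    TestFunctionClass.map_contDiff φ
  have hf : Continuous (fderiv ℝ (φ : EuclideanSpace ℝ (Fin n) → ℝ)) :=
    hd.continuous_fderiv (by simp)
  obtain ⟨C, hC⟩ := hf.bounded_above_of_compact_support
    ((TestFunctionClass.map_hasCompactSupport φ).fderiv (𝕜 := ℝ))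
  have hg : Continuous (gradient (φ : EuclideanSpace ℝ (Fin n) → ℝ)) :=
    (InnerProductSpace.toDual ℝ _).symm.continuous.comp hf
  have hu1 : Integrable u (lebesgue Ω) :=
    memLp_one_iff_integrable.1 (Lp.mem_Lp_iff_memLp.1 hu)
  refine hu1.smul_bdd C ?_ (Filter.Eventually.of_forall fun x => ?_)
  · exact (hg.comp continuous_subtype_val).aestronglyMeasurable
  · simpa [gradient] using hC x

lemma IsDistribGradient.add {u v : Ω →ₘ[(lebesgue Ω)] ℝ} {μ ν : VMeasure Ω}
    (hu : u ∈ Lp ℝ 1 (lebesgue Ω)) (hv : v ∈ Lp ℝ 1 (lebesgue Ω))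
    (h : IsDistribGradient u μ) (h' : IsDistribGradient v ν) :
    IsDistribGradient (u + v) (μ + ν) := by
  intro φ
  have e : ∫ᵛ x : Ω, φ (x : EuclideanSpace ℝ (Fin n)) ∂•(μ + ν).toVectorMeasure =
      (∫ᵛ x : Ω, φ (x : EuclideanSpace ℝ (Fin n)) ∂•μ.toVectorMeasure) +
      ∫ᵛ x : Ω, φ (x : EuclideanSpace ℝ (Fin n)) ∂•ν.toVectorMeasure :=
    VectorMeasure.integral_add_vectorMeasure (integrable_test μ φ) (integrable_test ν φ)
  rw [e, neg_add, ← h φ, ← h' φ,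
    ← integral_add (integrable_smul_gradient hu φ) (integrable_smul_gradient hv φ)]
  refine integral_congr_ae ?_
  filter_upwards [AEEqFun.coeFn_add u v] with x hx
  rw [hx, Pi.add_apply, add_smul]

lemma IsDistribGradient.smul {u : Ω →ₘ[(lebesgue Ω)] ℝ} {μ : VMeasure Ω} (c : ℝ)
    (h : IsDistribGradient u μ) : IsDistribGradient (c • u) (c • μ) := by
  intro φ
  have e : ∫ᵛ x : Ω, φ (x : EuclideanSpace ℝ (Fin n)) ∂•(c • μ).toVectorMeasure =
      c • ∫ᵛ x : Ω, φ (x : EuclideanSpace ℝ (Fin n)) ∂•μ.toVectorMeasure :=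
    VectorMeasure.integral_smul_vectorMeasure _ c
  rw [e, ← smul_neg, ← h φ, ← integral_smul]
  refine integral_congr_ae ?_
  filter_upwards [AEEqFun.coeFn_smul c u] with x hx
  rw [hx, Pi.smul_apply, smul_assoc]

lemma isDistribGradient_zero :
    IsDistribGradient (0 : Ω →ₘ[(lebesgue Ω)] ℝ) (0 : VMeasure Ω) := by
  have h : IsDistribGradient ((0 : ℝ) • (0 : Ω →ₘ[(lebesgue Ω)] ℝ))
      ((0 : ℝ) • (0 : VMeasure Ω)) := by
    intro φ
    have e : ∫ᵛ x : Ω, φ (x : EuclideanSpace ℝ (Fin n)) ∂•((0 : ℝ) • (0 : VMeasure Ω)).toVectorMeasure =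
        (0 : ℝ) • ∫ᵛ x : Ω, φ (x : EuclideanSpace ℝ (Fin n)) ∂•(0 : VMeasure Ω).toVectorMeasure :=
      VectorMeasure.integral_smul_vectorMeasure _ 0
    rw [e, zero_smul ℝ (_ : EuclideanSpace ℝ (Fin n)), neg_zero]
    refine (integral_congr_ae ?_).trans (integral_zero _ _)
    filter_upwards [AEEqFun.coeFn_smul (0 : ℝ) (0 : Ω →ₘ[(lebesgue Ω)] ℝ)] with x hx
    rw [hx]
    simp
  simpa using h

/-- A vector measure on `Ω` that annihilates all test functions vanishes. -/
lemma VMeasure.eq_zero_of_integral_test (μ : VMeasure Ω)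
    (h : ∀ φ : 𝓓(Ω, ℝ), ∫ᵛ x : Ω, φ (x : EuclideanSpace ℝ (Fin n)) ∂•μ.toVectorMeasure = 0) :
    μ = 0 := by
  have key : ∀ V : Set Ω, IsOpen V → μ.toVectorMeasure V = 0 := by
    intro V hV
    have hU : IsOpen (Subtype.val '' V : Set (EuclideanSpace ℝ (Fin n))) :=
      Ω.isOpen.isOpenMap_subtype_val V hV
    have hUΩ : (Subtype.val '' V : Set (EuclideanSpace ℝ (Fin n))) ⊆ Ω := by
      rintro _ ⟨x, -, rfl⟩; exact x.2
    have : LocallyCompactSpace V := by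
      have : LocallyCompactSpace Ω := Ω.isOpen.locallyCompactSpace
      exact hV.locallyCompactSpace
    let K : CompactExhaustion V := default
    let L : ℕ → Set (EuclideanSpace ℝ (Fin n)) := fun k =>
      (fun x : V => ((x : Ω) : EuclideanSpace ℝ (Fin n))) '' K k
    have hL : ∀ k, IsCompact (L k) := fun k =>
      (K.isCompact k).image (continuous_subtype_val.comp continuous_subtype_val)
    have hLU : ∀ k, L k ⊆ Subtype.val '' V := by
      rintro k _ ⟨x, -, rfl⟩
      exact ⟨x, x.2, rfl⟩
    have hex : ∀ k, ∃ φ : 𝓓(Ω, ℝ), (∀ x, φ x ∈ Icc (0 : ℝ) 1) ∧ (∀ x ∈ L k, φ x = 1) ∧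
        ∀ x ∉ (Subtype.val '' V : Set (EuclideanSpace ℝ (Fin n))), φ x = 0 := by
      intro k
      obtain ⟨W, hWo, hLW, hWU, hWc⟩ :=
        exists_open_between_and_isCompact_closure (hL k) hU (hLU k)
      obtain ⟨g, hg, hgr, hgs, hg1⟩ := exists_contMDiff_support_eq_eq_one_iff
        (modelWithCornersSelf ℝ (EuclideanSpace ℝ (Fin n))) (n := (⊤ : ℕ∞))
        hWo (hL k).isClosed hLW
      have hts : tsupport g = closure W := by rw [tsupport, hgs]
      refine ⟨⟨g, hg.contDiff, ?_, ?_⟩, fun x => hgr (mem_range_self x),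
        fun x hx => (hg1 x).1 hx, fun x hx => ?_⟩
      · rw [HasCompactSupport, hts]; exact hWc
      · rw [hts]; exact hWU.trans hUΩ
      · change g x = 0
        rw [← Function.notMem_support, hgs]
        exact fun hxW => hx (hWU (subset_closure hxW))
    choose φ hφ01 hφ1 hφ0 using hex
    have lim : Filter.Tendsto
        (fun k => ∫ᵛ x : Ω, φ k (x : EuclideanSpace ℝ (Fin n)) ∂•μ.toVectorMeasure) Filter.atTop
        (𝓝 (∫ᵛ x : Ω, V.indicator (fun _ => (1 : ℝ)) x ∂•μ.toVectorMeasure)) := by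
      refine VectorMeasure.tendsto_integral_of_dominated_convergence (fun _ => (1 : ℝ))
        (fun k => ((map_continuous (φ k)).comp continuous_subtype_val).aestronglyMeasurable)
        (integrable_const _) (fun k => Filter.Eventually.of_forall fun x => ?_)
        (Filter.Eventually.of_forall fun x => ?_)
      · rw [Real.norm_of_nonneg (hφ01 k x).1]
        exact (hφ01 k x).2
      · by_cases hx : x ∈ V
        · rw [indicator_of_mem hx]
          obtain ⟨k₀, hk₀⟩ := K.exists_mem ⟨x, hx⟩
          refine tendsto_const_nhds.congr' ?_
          filter_upwards [Filter.eventually_ge_atTop k₀] with k hk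
          exact (hφ1 k x ⟨⟨x, hx⟩, K.subset hk hk₀, rfl⟩).symm
        · rw [indicator_of_notMem hx]
          refine tendsto_const_nhds.congr fun k => ?_
          refine (hφ0 k x ?_).symm
          rintro ⟨y, hy, hyx⟩
          exact hx (Subtype.ext hyx ▸ hy)
    rw [VectorMeasure.integral_indicator_const _ hV.measurableSet] at lim
    simp only [h, ContinuousLinearMap.lsmul_apply, one_smul] at lim
    exact (tendsto_nhds_unique tendsto_const_nhds lim).symm
  exact VectorMeasure.ext_of_generateFrom (μ := μ.toVectorMeasure)
    (ν := (0 : VectorMeasure Ω (EuclideanSpace ℝ (Fin n)))) {s : Set Ω | IsOpen s}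
    (fun s hs => by rw [key s hs]; rfl) (BorelSpace.measurable_eq (α := Ω))
    isPiSystem_isOpen (by rw [key univ isOpen_univ]; rfl)

/-- The distributional gradient is unique. -/
lemma IsDistribGradient.unique {u : Ω →ₘ[(lebesgue Ω)] ℝ} {μ ν : VMeasure Ω}
    (h : IsDistribGradient u μ) (h' : IsDistribGradient u ν) : μ = ν := by
  rw [← sub_eq_zero]
  refine VMeasure.eq_zero_of_integral_test _ fun φ => ?_
  have e : ∫ᵛ x : Ω, φ (x : EuclideanSpace ℝ (Fin n)) ∂•(μ - ν).toVectorMeasure =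
      (∫ᵛ x : Ω, φ (x : EuclideanSpace ℝ (Fin n)) ∂•μ.toVectorMeasure) -
      ∫ᵛ x : Ω, φ (x : EuclideanSpace ℝ (Fin n)) ∂•ν.toVectorMeasure :=
    VectorMeasure.integral_sub_vectorMeasure (integrable_test μ φ) (integrable_test ν φ)
  rw [e, sub_eq_zero, ← neg_inj, ← h φ, ← h' φ]

variable (Ω)

/-- `BV(Ω)`: the functions in `L¹(Ω)` (modulo equality a.e.) whose distributional gradient is a
measure in `𝓜(Ω)ⁿ`. -/
def BV : Submodule ℝ (Ω →ₘ[(lebesgue Ω)] ℝ) where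
  carrier := {u | u ∈ Lp ℝ 1 (lebesgue Ω) ∧ ∃ μ : VMeasure Ω, IsDistribGradient u μ}
  zero_mem' := ⟨zero_mem _, 0, isDistribGradient_zero⟩
  add_mem' := by
    rintro u v ⟨hu, μ, hμ⟩ ⟨hv, ν, hν⟩
    exact ⟨add_mem hu hv, μ + ν, hμ.add hu hv hν⟩
  smul_mem' := by
    rintro c u ⟨hu, μ, hμ⟩
    exact ⟨Lp.const_smul_mem_Lp c ⟨u, hu⟩, c • μ, hμ.smul c⟩

variable {Ω}

namespace BV

/-- The inclusion `BV(Ω) → L¹(Ω)`. -/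
def toL1 : BV Ω →ₗ[ℝ] Lp ℝ 1 (lebesgue Ω) where
  toFun u := ⟨u.1, u.2.1⟩
  map_add' _ _ := rfl
  map_smul' _ _ := rfl

/-- The gradient `∇ : BV(Ω) → 𝓜(Ω)ⁿ`. -/
def grad : BV Ω →ₗ[ℝ] VMeasure Ω where
  toFun u := u.2.2.choose
  map_add' u v := (u + v).2.2.choose_spec.unique
    (u.2.2.choose_spec.add u.2.1 v.2.1 v.2.2.choose_spec)
  map_smul' c u := (c • u).2.2.choose_spec.unique (u.2.2.choose_spec.smul c)

lemma grad_spec (u : BV Ω) : IsDistribGradient (u : Ω →ₘ[(lebesgue Ω)] ℝ) (grad u) :=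
  u.2.2.choose_spec

/-- The `BV`-seminorm `|∇u|(Ω)`. -/
def seminorm (u : BV Ω) : ℝ := ‖grad u‖

/-- The norm `‖u‖_{BV} = ‖u‖_{L¹} + |∇u|(Ω)`. -/
def bvNorm (u : BV Ω) : ℝ := ‖toL1 u‖ + seminorm u

end BV

variable (Ω)

/-- The space `X = BV(Ω) ∩ L²(Ω)`. -/
def BVL2 : Type := ↥(BV Ω ⊓ Lp.LpSubmodule ℝ ℝ 2 (lebesgue Ω))

variable {Ω}

namespace BVL2

instance : AddCommGroup (BVL2 Ω) :=
  inferInstanceAs (AddCommGroup ↥(BV Ω ⊓ Lp.LpSubmodule ℝ ℝ 2 (lebesgue Ω)))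

instance : Module ℝ (BVL2 Ω) :=
  inferInstanceAs (Module ℝ ↥(BV Ω ⊓ Lp.LpSubmodule ℝ ℝ 2 (lebesgue Ω)))

/-- The inclusion `BV(Ω) ∩ L²(Ω) → BV(Ω)`, as a linear map. -/
def toBV : BVL2 Ω →ₗ[ℝ] BV Ω where
  toFun u := ⟨u.1, u.2.1⟩
  map_add' _ _ := rfl
  map_smul' _ _ := rfl

/-- The inclusion `BV(Ω) ∩ L²(Ω) → L²(Ω)`, as a linear map. -/
def toL2ₗ : BVL2 Ω →ₗ[ℝ] Lp ℝ 2 (lebesgue Ω) where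
  toFun u := ⟨u.1, u.2.2⟩
  map_add' _ _ := rfl
  map_smul' _ _ := rfl

/-- The norm `‖u‖ = ‖u‖_{BV} + ‖u‖_{L²}` on `BV(Ω) ∩ L²(Ω)`. -/
instance : Norm (BVL2 Ω) := ⟨fun u => BV.bvNorm (toBV u) + ‖toL2ₗ u‖⟩

lemma norm_def (u : BVL2 Ω) : ‖u‖ = BV.bvNorm (toBV u) + ‖toL2ₗ u‖ := rfl

lemma norm_eq (u : BVL2 Ω) :
    ‖u‖ = ‖BV.toL1 (toBV u)‖ + ‖BV.grad (toBV u)‖ + ‖toL2ₗ u‖ := rfl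

instance : NormedAddCommGroup (BVL2 Ω) :=
  AddGroupNorm.toNormedAddCommGroup
    { toFun := fun u => ‖u‖
      map_zero' := by simp [norm_eq]
      add_le' := fun u v => by
        simp only [norm_eq, map_add]
        have h1 := norm_add_le (BV.toL1 (toBV u)) (BV.toL1 (toBV v))
        have h2 := norm_add_le (BV.grad (toBV u)) (BV.grad (toBV v))
        have h3 := norm_add_le (toL2ₗ u) (toL2ₗ v)
        linarith
      neg' := fun u => by simp only [norm_eq, map_neg, norm_neg]
      eq_zero_of_map_eq_zero' := fun u h => by
        have h' : ‖BV.toL1 (toBV u)‖ + ‖BV.grad (toBV u)‖ + ‖toL2ₗ u‖ = 0 := h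
        have h1 := norm_nonneg (BV.toL1 (toBV u))
        have h2 := norm_nonneg (BV.grad (toBV u))
        have h3 := norm_nonneg (toL2ₗ u)
        have h4 : toL2ₗ u = 0 := norm_eq_zero.1 (by linarith)
        exact Subtype.ext (congrArg (Subtype.val : Lp ℝ 2 (lebesgue Ω) → _) h4) }

instance : NormedSpace ℝ (BVL2 Ω) where
  norm_smul_le c u := by
    simp only [norm_eq, map_smul, norm_smul]
    apply le_of_eq
    ring

/-- The continuous inclusion `BV(Ω) ∩ L²(Ω) → L²(Ω)`. -/
def toL2 : BVL2 Ω →L[ℝ] Lp ℝ 2 (lebesgue Ω) :=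
  toL2ₗ.mkContinuous 1 fun u => by
    rw [norm_eq, one_mul]
    have h1 := norm_nonneg (BV.toL1 (toBV u))
    have h2 := norm_nonneg (BV.grad (toBV u))
    linarith

/-- The gradient `∇ : BV(Ω) ∩ L²(Ω) → 𝓜(Ω)ⁿ` as a continuous linear map. -/
def grad : BVL2 Ω →L[ℝ] VMeasure Ω :=
  (BV.grad.comp toBV).mkContinuous 1 fun u => by
    rw [norm_eq, one_mul]
    have h1 := norm_nonneg (BV.toL1 (toBV u))
    have h3 := norm_nonneg (toL2ₗ u)
    simp only [LinearMap.comp_apply]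
    linarith

/-- The operator `-div : (𝓜(Ω)ⁿ)* → (BV(Ω) ∩ L²(Ω))*`, the adjoint of the gradient:
`⟨-div l, u⟩ = ⟨l, ∇u⟩`. -/
def negDiv (l : StrongDual ℝ (VMeasure Ω)) : StrongDual ℝ (BVL2 Ω) := l.comp grad

/-- The embedding `L²(Ω) → (BV(Ω) ∩ L²(Ω))*`, `⟨g, v⟩ = ∫_Ω g v dx`. -/
def ofL2 (g : Lp ℝ 2 (lebesgue Ω)) : StrongDual ℝ (BVL2 Ω) := (innerSL ℝ g).comp toL2

end BVL2

end BV

/-! ### Convex analysis -/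

/-- The convex subdifferential `∂h(x) ⊆ V*` of `h : V → ℝ`. -/
def subdifferential {V : Type*} [NormedAddCommGroup V] [NormedSpace ℝ V] (h : V → ℝ) (x : V) :
    Set (StrongDual ℝ V) :=
  {l | ∀ y, h x + l (y - x) ≤ h y}

/-- The normal cone `N_C(x) ⊆ V*` of `C ⊆ V` at a point `x ∈ C`. -/
def normalCone {V : Type*} [NormedAddCommGroup V] [NormedSpace ℝ V] (C : Set V) (x : V) :
    Set (StrongDual ℝ V) :=
  {l | ∀ y ∈ C, l (y - x) ≤ 0}

/-- The objective `J(u) = f(u) + |∇u|(Ω)` on `BV(Ω) ∩ L²(Ω)`. -/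
def objective {n : ℕ} {Ω : Opens (EuclideanSpace ℝ (Fin n))}
    (f : Lp ℝ 2 (lebesgue Ω) → ℝ) (u : BVL2 Ω) : ℝ :=
  f (BVL2.toL2 u) + BV.seminorm (BVL2.toBV u)

end

/-! The objective is a smooth term plus a convex one, so only the smooth term needs linearizing. On
the segment from `ubar` to an admissible `u`, the total variation of the gradient lies below its
chord; dividing the local optimality inequality by the step length and letting it tend to zero shows
that `ubar` minimizes the convex functional `u ↦ ∫ ∇f(ubar) u + |∇u|(Ω)` over all admissible `u`,
not just nearby ones (`norm_grad_le_of_isLocalMin`).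

It remains to split the optimality condition of this convex problem into a subgradient of the norm
and a normal vector (`exists_mem_subdifferential_of_forall_le`). The separation argument takes place
in `VMeasure Ω × ℝ` rather than in `BVL2 Ω`, so the multiplier is a functional on all measures, not
only on gradients. No constraint qualification is needed, because the norm is finite and continuous
everywhere. -/

/-- One-sided Fermat rule: if `f + k t` restricted to a ray is minimal at the base point among small
`t > 0`, then its directional derivative is nonnegative. -/
lemma HasFDerivAt.nonneg_add_of_eventually_le {V : Type*} [NormedAddCommGroup V] [NormedSpace ℝ V]
    {f : V → ℝ} {f' : StrongDual ℝ V} {x d : V} {k : ℝ} (hf : HasFDerivAt f f' x)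
    (h : ∀ᶠ t in 𝓝[>] (0 : ℝ), f x ≤ f (x + t • d) + t * k) : 0 ≤ f' d + k := by
  have hline : HasDerivAt (fun t : ℝ => f (x + t • d)) (f' d) 0 := hf.hasLineDerivAt d
  -- Adding `k` to the difference quotient of `f` gives that of `f (x + t • d) + t * k`, which is
  -- nonnegative for small `t > 0`.
  have lim := hline.tendsto_slope_zero_right.add_const k
  refine ge_of_tendsto lim ?_
  filter_upwards [h, self_mem_nhdsWithin] with t ht htpos
  have htpos : 0 < t := htpos
  have e : t⁻¹ • (f (x + (0 + t) • d) - f (x + (0 : ℝ) • d)) + k =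
      t⁻¹ * (f (x + t • d) + t * k - f x) := by
    simp only [zero_add, zero_smul, add_zero, smul_eq_mul]
    field_simp
    ring
  rw [e]
  exact mul_nonneg (inv_nonneg.2 htpos.le) (sub_nonneg.2 ht)

/-- Sum and chain rule of convex analysis: if `x₀` minimizes `g + h ∘ T` over the convex set `C`,
where `g` and `T` are linear and `h` is convex and continuous, then a subgradient `l` of `h` at
`T x₀` exists with `g + l ∘ T` minimal at `x₀` over `C`. -/
lemma exists_mem_subdifferential_of_forall_le {X V : Type*} [AddCommGroup X] [Module ℝ X]
    [NormedAddCommGroup V] [NormedSpace ℝ V] {h : V → ℝ} (hconv : ConvexOn ℝ univ h)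
    (hcont : Continuous h) (T : X →ₗ[ℝ] V) (g : X →ₗ[ℝ] ℝ) {C : Set X} (hC : Convex ℝ C)
    {x₀ : X} (hx₀ : x₀ ∈ C) (hmin : ∀ x ∈ C, h (T x₀) ≤ g (x - x₀) + h (T x)) :
    ∃ l ∈ subdifferential h (T x₀), ∀ x ∈ C, 0 ≤ g (x - x₀) + l (T (x - x₀)) := by
  -- Minimality of `x₀` says that the strict epigraph `A` of `h` misses the region `B`, which lies
  -- on or below the values `h (T x₀) - g (x - x₀)` over the points `T x`. Strictness makes `A`
  -- open, as Hahn–Banach separation requires.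
  let A : Set (V × ℝ) := {p | h p.1 < p.2}
  let B : Set (V × ℝ) := {p | ∃ x ∈ C, T x = p.1 ∧ p.2 ≤ h (T x₀) - g (x - x₀)}
  have hAconv : Convex ℝ A := by
    simpa [A] using hconv.convex_strict_epigraph
  have hAopen : IsOpen A := isOpen_lt (hcont.comp continuous_fst) continuous_snd
  have hBconv : Convex ℝ B := by
    rintro ⟨v, s⟩ ⟨x, hx, hxv, hs⟩ ⟨w, t⟩ ⟨y, hy, hyw, ht⟩ a b ha hb hab
    refine ⟨a • x + b • y, hC hx hy ha hb hab, by simp_all, ?_⟩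
    simp only [Prod.smul_mk, Prod.mk_add_mk, smul_eq_mul, map_sub, map_add, map_smul] at hs ht ⊢
    have h1 := mul_le_mul_of_nonneg_left hs ha
    have h2 := mul_le_mul_of_nonneg_left ht hb
    obtain rfl : b = 1 - a := by linarith
    linarith
  have hdisj : Disjoint A B := by
    rw [Set.disjoint_left]
    rintro ⟨v, s⟩ hA ⟨x, hx, rfl, hs⟩
    have h1 := hmin x hx
    have h2 : h (T x) < s := hA
    simp only at hs
    linarith
  obtain ⟨F, c, hFA, hFB⟩ := geometric_hahn_banach_open hAconv hAopen hBconv hdisj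
  let m : StrongDual ℝ V := F.comp (ContinuousLinearMap.inl ℝ V ℝ)
  let τ : ℝ := F (0, 1)
  have hF : ∀ v t, F (v, t) = m v + t * τ := by
    intro v t
    have : (v, t) = (v, (0 : ℝ)) + t • ((0 : V), (1 : ℝ)) := by simp
    rw [this, map_add, map_smul]
    rfl
  have hA : ∀ v t, h v < t → m v + t * τ < c := fun v t hvt => hF v t ▸ hFA (v, t) hvt
  have hB : ∀ x ∈ C, c ≤ m (T x) + (h (T x₀) - g (x - x₀)) * τ := fun x hx => by
    rw [← hF]
    exact hFB _ ⟨x, hx, rfl, le_rfl⟩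
  have hB₀ : c ≤ m (T x₀) + h (T x₀) * τ := by simpa using hB x₀ hx₀
  -- The hyperplane is not vertical: `A` contains a point directly above `(T x₀, h (T x₀))`, which
  -- lies in `B`.
  have hτ : τ < 0 := by
    have := hA (T x₀) (h (T x₀) + 1) (by linarith)
    linarith
  -- The bound passes from the strict epigraph to the graph: raising the height by `ε / (-τ)`
  -- changes the functional by exactly `-ε`.
  have hA' : ∀ v, m v + h v * τ ≤ c := fun v => by
    refine le_of_forall_pos_lt_add fun ε hε => ?_
    have hpos : 0 < ε / (-τ) := div_pos hε (by linarith)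
    have h1 := hA v (h v + ε / (-τ)) (by linarith)
    have h2 : ε / (-τ) * τ = -ε := by
      field_simp [hτ.ne]
    linarith
  -- The point over `T x₀` is both on the graph of `h` and in `B`, so the hyperplane passes through
  -- it.
  have hc : c = m (T x₀) + h (T x₀) * τ := le_antisymm hB₀ (hA' _)
  have hσ : 0 < (-τ)⁻¹ := inv_pos.2 (by linarith)
  have hστ : (-τ)⁻¹ * τ = -1 := by field_simp [hτ.ne]
  -- Scaling the vertical coefficient to `-1` turns the hyperplane into the graph of an affine
  -- function with slope `(-τ)⁻¹ • m`. It supports `h` from below and bounds `B` from above; these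
  -- are the two claims.
  refine ⟨(-τ)⁻¹ • m, fun v => ?_, fun x hx => ?_⟩
  · have h1 := mul_le_mul_of_nonneg_left ((hA' v).trans_eq hc) hσ.le
    simp only [smul_apply, smul_eq_mul, map_sub]
    linear_combination h1 - (h v - h (T x₀)) * hστ
  · have h1 := mul_le_mul_of_nonneg_left (hc.symm.trans_le (hB x hx)) hσ.le
    simp only [smul_apply, smul_eq_mul, map_sub] at h1 ⊢
    linear_combination h1 - (g x - g x₀) * hστ

/-- First-order condition: a local minimizer `ubar` of the objective over `Uad` minimizes
`u ↦ f'(ubar) u + |∇u|(Ω)` over `Uad`. -/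
lemma norm_grad_le_of_isLocalMin {n : ℕ} {Ω : Opens (EuclideanSpace ℝ (Fin n))}
    {Uad : Set (Lp ℝ 2 (lebesgue Ω))} (hUconv : Convex ℝ Uad)
    {f : Lp ℝ 2 (lebesgue Ω) → ℝ} {ubar : BVL2 Ω}
    (hf : DifferentiableAt ℝ f (BVL2.toL2 ubar)) (hubar : BVL2.toL2 ubar ∈ Uad)
    {r : ℝ} (hr : 0 < r)
    (hloc : ∀ u : BVL2 Ω, BVL2.toL2 u ∈ Uad → ‖u - ubar‖ < r → objective f ubar ≤ objective f u)
    {u : BVL2 Ω} (hu : BVL2.toL2 u ∈ Uad) :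
    ‖BVL2.grad ubar‖ ≤
      BVL2.ofL2 (gradient f (BVL2.toL2 ubar)) (u - ubar) + ‖BVL2.grad u‖ := by
  have hg := hf.hasGradientAt.hasFDerivAt
  -- The constant `k` of the Fermat rule is the slope of the chord of `|∇·|(Ω)` from `ubar` to `u`.
  suffices 0 ≤ InnerProductSpace.toDual ℝ _ (gradient f (BVL2.toL2 ubar))
      (BVL2.toL2 (u - ubar)) + (‖BVL2.grad u‖ - ‖BVL2.grad ubar‖) by
    have e : BVL2.ofL2 (gradient f (BVL2.toL2 ubar)) (u - ubar) =
      InnerProductSpace.toDual ℝ _ (gradient f (BVL2.toL2 ubar)) (BVL2.toL2 (u - ubar)) := rfl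
    linarith
  refine hg.nonneg_add_of_eventually_le ?_
  have hsmall : ∀ᶠ t in 𝓝[>] (0 : ℝ), t * ‖u - ubar‖ < r := by
    have : Filter.Tendsto (fun t : ℝ => t * ‖u - ubar‖) (𝓝[>] 0) (𝓝 (0 * ‖u - ubar‖)) :=
      ((continuous_id.mul continuous_const).tendsto 0).mono_left nhdsWithin_le_nhds
    exact this.eventually_lt_const (by simpa using hr)
  filter_upwards [hsmall, Ioc_mem_nhdsGT (zero_lt_one' ℝ)] with t ht ht01
  have hmem : BVL2.toL2 (ubar + t • (u - ubar)) ∈ Uad := by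
    rw [map_add, map_smul, map_sub]
    exact hUconv.add_smul_sub_mem hubar hu ⟨ht01.1.le, ht01.2⟩
  have hle := hloc _ hmem (by
    rw [add_sub_cancel_left, norm_smul, Real.norm_of_nonneg ht01.1.le]
    exact ht)
  have hle' : f (BVL2.toL2 ubar) + ‖BVL2.grad ubar‖ ≤
      f (BVL2.toL2 (ubar + t • (u - ubar))) + ‖BVL2.grad (ubar + t • (u - ubar))‖ := hle
  have hn : ‖BVL2.grad (ubar + t • (u - ubar))‖ ≤
      ‖BVL2.grad ubar‖ + t * (‖BVL2.grad u‖ - ‖BVL2.grad ubar‖) := by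
    have e : BVL2.grad (ubar + t • (u - ubar)) =
        (1 - t) • BVL2.grad ubar + t • BVL2.grad u := by
      rw [map_add, map_smul, map_sub]
      module
    rw [e]
    refine (norm_add_le _ _).trans_eq ?_
    rw [norm_smul, norm_smul, Real.norm_of_nonneg ht01.1.le,
      Real.norm_of_nonneg (sub_nonneg.2 ht01.2)]
    ring
  rw [map_add, map_smul] at hle'
  linarith

theorem theorem2p5 {n : ℕ} (Ω : Opens (EuclideanSpace ℝ (Fin n)))
    (Uad : Set (Lp ℝ 2 (lebesgue Ω)))
    (hUconv : Convex ℝ Uad) (hUclosed : IsClosed Uad)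
    (hUne : ∃ u : BVL2 Ω, BVL2.toL2 u ∈ Uad)
    (f : Lp ℝ 2 (lebesgue Ω) → ℝ) (hf : ContDiff ℝ 1 f)
    (ubar : BVL2 Ω) (hubar : BVL2.toL2 ubar ∈ Uad)
    (hloc : ∃ r : ℝ, 0 < r ∧ ∀ u : BVL2 Ω, BVL2.toL2 u ∈ Uad →
      BV.bvNorm (BVL2.toBV (u - ubar)) + ‖BVL2.toL2 (u - ubar)‖ < r →
        objective f ubar ≤ objective f u) :
    ∃ l : StrongDual ℝ (VMeasure Ω),
      l ∈ subdifferential (fun μ : VMeasure Ω => ‖μ‖) (BVL2.grad ubar) ∧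
      -BVL2.ofL2 (gradient f (BVL2.toL2 ubar)) ∈
        {BVL2.negDiv l} + normalCone {u : BVL2 Ω | BVL2.toL2 u ∈ Uad} ubar := by
  obtain ⟨r, hr, hloc⟩ := hloc
  obtain ⟨l, hl, hle⟩ := exists_mem_subdifferential_of_forall_le (convexOn_norm convex_univ)
    continuous_norm (BVL2.grad : BVL2 Ω →L[ℝ] VMeasure Ω).toLinearMap
    (BVL2.ofL2 (gradient f (BVL2.toL2 ubar))).toLinearMap
    (hUconv.linear_preimage (BVL2.toL2 : BVL2 Ω →L[ℝ] _).toLinearMap) hubar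
    fun u hu => norm_grad_le_of_isLocalMin hUconv
      ((hf.differentiable one_ne_zero).differentiableAt) hubar hr hloc hu
  -- The decomposition forces the normal vector to be the remainder after subtracting `BVL2.negDiv
  -- l`; its sign condition is the second conclusion of the separation lemma.
  refine ⟨l, hl, Set.mem_add.2 ⟨_, rfl, -BVL2.ofL2 (gradient f (BVL2.toL2 ubar)) - BVL2.negDiv l,
    fun u hu => ?_, add_sub_cancel _ _⟩⟩
  have h1 : 0 ≤ BVL2.ofL2 (gradient f (BVL2.toL2 ubar)) (u - ubar) +
    BVL2.negDiv l (u - ubar) := hle u hu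
  rw [sub_apply, neg_apply]
  linarith
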